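/- Fix a constant $\kappa>0$. Inputs are simple undirected graphs $G$ on the vertex set $\{1,\dots,n\}$ with at most $m$ edges, where the bound $m$ satisfies $m\ge\kappa n$; $n$ and $m$ are known to the algorithm. The algorithm accesses $G$ through an adjacency-list oracle: a query asks for the degree of a vertex $v$, or for the $i$-th neighbor of $v$ in an arbitrary fixed ordering of its neighbors. The distance of two graphs on the same vertex set is the number of unordered pairs that are an edge of exactly one of them, divided by $m$. A graph is $\eta$-close to a property (a set of graphs) if its distance to some graph with the property is at most $\eta$, and $\eta$-far otherwise. Disconnected graphs have infinite diameter. For all integers $D>0$, all real $\alpha,\beta,\varepsilon>0$ and every constant $0<c<1$, there is an $(\varepsilon,\ (3+\alpha)\varepsilon+\frac1m+c+\beta,\ 4D+6)$-tolerant tester for having diameter at most $D$, for $n\ge 1/c$. That is, there is a randomized algorithm which, for all $n\ge 1/c$ and $m\ge\kappa n$ and on every such input graph $G$ (in every adjacency-list representation), makes at most $q(m)$ queries, where $q(m)=o(m)$ as $m\to\infty$ and $q$ may depend on $D,\alpha,\beta,\varepsilon,c,\kappa$ only, and such that - if $G$ is $\varepsilon$-close to having diameter at most $D$, then the algorithm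 accepts with probability at least $2/3$; - if $G$ is $\bigl((3+\alpha)\varepsilon+\frac1m+c+\beta\bigr)$-far from having diameter at most $4D+6$, then the algorithm accepts with probability at most $1/3$. -/

import Mathlib

noncomputable section

namespace TolerantTesting

/-- An adjacency-list representation of a graph `G` : every vertex carries an ordered list,
without repetitions, of exactly its neighbors. The order is arbitrary. -/
structure AdjacencyList {n : ℕ} (G : SimpleGraph (Fin n)) where
  nbrs : Fin n → List (Fin n)
  nodup : ∀ v, (nbrs v).Nodup
  mem_iff : ∀ v u, u ∈ nbrs v ↔ G.Adj v u

/-- A deterministic adaptive algorithm with access to a neighbor oracle on the vertex set `Fin n`,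
given as a decision tree. It either halts with a verdict (`true` means "accept"), or asks for the
degree of `v`, or asks for the `i`-th neighbor of `v`, and continues according to the reply. -/
inductive QueryAlg (n : ℕ) : Type where
  | halt (verdict : Bool) : QueryAlg n
  | askDegree (v : Fin n) (next : ℕ → QueryAlg n) : QueryAlg n
  | askNeighbor (v : Fin n) (i : ℕ) (next : Option (Fin n) → QueryAlg n) : QueryAlg n

/-- The verdict of the algorithm on the neighbor oracle given by `A`. The neighbors are numbered
from `0`; the oracle replies `none` if the index is at least the degree. -/
def QueryAlg.run {n : ℕ} {G : SimpleGraph (Fin n)} (A : AdjacencyList G) : QueryAlg n → Bool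
  | .halt b => b
  | .askDegree v next => (next (A.nbrs v).length).run A
  | .askNeighbor v i next => (next (A.nbrs v)[i]?).run A

/-- The number of oracle queries made by the algorithm on the neighbor oracle given by `A`. -/
def QueryAlg.queries {n : ℕ} {G : SimpleGraph (Fin n)} (A : AdjacencyList G) : QueryAlg n → ℕ
  | .halt _ => 0
  | .askDegree v next => (next (A.nbrs v).length).queries A + 1
  | .askNeighbor v i next => (next (A.nbrs v)[i]?).queries A + 1

/-- A randomized algorithm with access to a neighbor oracle: its coin tosses select a
deterministic one. -/
abbrev RandQueryAlg (n : ℕ) : Type := PMF (QueryAlg n)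

/-- The probability, over the coin tosses, that the algorithm accepts. -/
def acceptProb {n : ℕ} {G : SimpleGraph (Fin n)} (T : RandQueryAlg n) (A : AdjacencyList G) : ℝ :=
  ((T.map (QueryAlg.run A)) true).toReal

/-- The distance between two graphs relative to the edge bound `m` : the number of unordered
pairs that are an edge of exactly one of them, divided by `m`. -/
def graphDist {n : ℕ} (m : ℕ) (G₁ G₂ : SimpleGraph (Fin n)) : ℝ :=
  ((symmDiff G₁.edgeSet G₂.edgeSet).ncard : ℝ) / m

/-- A graph property: a set of graphs on each vertex set `Fin n`. -/
abbrev GraphProperty : Type := (n : ℕ) → Set (SimpleGraph (Fin n))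

/-- `G` is `ε`-close to `P` : the minimum of the distances from `G` to the members of `P`
is at most `ε`. (There are finitely many graphs on `Fin n`, so the minimum is attained.) -/
def IsClose (m : ℕ) (ε : ℝ) (P : GraphProperty) {n : ℕ} (G : SimpleGraph (Fin n)) : Prop :=
  ∃ G' ∈ P n, graphDist m G G' ≤ ε

/-- `G` is `ε`-far from `P` if it is not `ε`-close to `P`. -/
def IsFar (m : ℕ) (ε : ℝ) (P : GraphProperty) {n : ℕ} (G : SimpleGraph (Fin n)) : Prop :=
  ¬ IsClose m ε P G

/-- `T` is an `(ε₁, ε₂, φ)`-tolerant tester for the parametrized property `P` at the parameter `s`.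
The algorithm is given the number `n` of vertices and the bound `m` on the number of edges; the
proximity parameters may depend on `m`. The guarantees are for the pairs `(n, m)` that satisfy
`Admissible`, and for every graph on `n` vertices with at most `m` edges, in every adjacency-list
representation. -/
structure IsTolerantTester (P : ℕ → GraphProperty) (s : ℕ) (φ : ℕ → ℕ) (ε₁ ε₂ : ℕ → ℝ)
    (Admissible : ℕ → ℕ → Prop) (T : (n m : ℕ) → RandQueryAlg n) : Prop where
  /-- The number of queries is `o(m)`, for all coin tosses. -/
  query_bound : ∃ q : ℕ → ℕ,
    Asymptotics.IsLittleO Filter.atTop (fun m : ℕ => (q m : ℝ)) (fun m : ℕ => (m : ℝ)) ∧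
    ∀ n m : ℕ, Admissible n m →
      ∀ (G : SimpleGraph (Fin n)) (A : AdjacencyList G), G.edgeSet.ncard ≤ m →
        ∀ t ∈ (T n m).support, QueryAlg.queries A t ≤ q m
  /-- Graphs that are close to the property are accepted with probability at least `2/3`. -/
  accept_close : ∀ n m : ℕ, Admissible n m →
    ∀ (G : SimpleGraph (Fin n)) (A : AdjacencyList G), G.edgeSet.ncard ≤ m →
      IsClose m (ε₁ m) (P s) G → 2 / 3 ≤ acceptProb (T n m) A
  /-- Graphs that are far from the relaxed property are accepted with probability at most `1/3`. -/
  reject_far : ∀ n m : ℕ, Admissible n m →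
    ∀ (G : SimpleGraph (Fin n)) (A : AdjacencyList G), G.edgeSet.ncard ≤ m →
      IsFar m (ε₂ m) (P (φ s)) G → acceptProb (T n m) A ≤ 1 / 3

/-- The parametrized property of having diameter at most `D` (a disconnected graph has infinite
diameter). -/
def diamAtMost (D : ℕ) : GraphProperty := fun _ => {G | G.ediam ≤ (D : ℕ∞)}

end TolerantTesting

end

/-! Call a vertex low if its `2 * D`-ball contains no vertex of degree above a constant `Δ`. Take a
maximal set of low vertices ("centers") at pairwise distance more than `2 * D`. Its size decides
between the two cases. If adding `k` edges (and removing others) gives diameter at most `D`, there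
are at most `k + 1` centers (`card_le_of_ediam_le`): follow shortest paths in the new graph towards
a root; distinct centers leave `G` through distinct added edges, apart from at most one that reaches
the root. Conversely, the centers and the vertices of degree above `Δ` cover everything within `2 *
D`. Joining them in a star yields diameter at most `4 * D + 2` (`exists_ediam_le`), and by Markov
there are at most `c * m / 4` vertices of high degree. A constant number of queries suffices to
estimate the count. A greedy choice in the order of a random coloring with constantly many colors is
local, since balls around low vertices have bounded size. Equal colors inside a ball spoil the
separation only at few "conflicts" (`sum_card_conflicts_mul_le`). Membership of random vertices then
estimates the number of centers by Chebyshev (`sum_sq_sizeEstimate_sub_le`). -/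

namespace TolerantTesting

/-! ### Composable oracle programs with query bounds. -/

/-- `f` can be evaluated on every neighbor oracle with at most `q` queries: some program, given in
continuation-passing style, passes its value on. -/
def Computes {n : ℕ} {γ : Type} (f : (Fin n → List (Fin n)) → γ) (q : ℕ) : Prop :=
  ∃ p : (γ → QueryAlg n) → QueryAlg n, ∀ (k : γ → QueryAlg n) (G : SimpleGraph (Fin n))
    (A : AdjacencyList G), (p k).run A = (k (f A.nbrs)).run A ∧
      (p k).queries A ≤ q + (k (f A.nbrs)).queries A

namespace Computes

variable {n : ℕ} {γ δ ι : Type}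

theorem const (b : γ) : Computes (fun _ : Fin n → List (Fin n) => b) 0 :=
  ⟨fun k => k b, fun _ _ _ => ⟨rfl, by simp⟩⟩

theorem mono {f : (Fin n → List (Fin n)) → γ} {q q' : ℕ} (h : Computes f q) (hq : q ≤ q') :
    Computes f q' := by
  obtain ⟨p, hp⟩ := h
  exact ⟨p, fun k G A => ⟨(hp k G A).1, (hp k G A).2.trans (by gcongr)⟩⟩

/-- The bound `q'` has to hold for every conceivable intermediate value `b`, not only for those that
`f` attains. -/
theorem bind {f : (Fin n → List (Fin n)) → γ} {g : γ → (Fin n → List (Fin n)) → δ} {q q' : ℕ}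
    (hf : Computes f q) (hg : ∀ b, Computes (g b) q') :
    Computes (fun nb => g (f nb) nb) (q + q') := by
  obtain ⟨p, hp⟩ := hf
  choose r hr using hg
  refine ⟨fun k => p fun b => r b k, fun k G A => ?_⟩
  obtain ⟨h₁, h₂⟩ := hp (fun b => r b k) G A
  obtain ⟨h₃, h₄⟩ := hr (f A.nbrs) k G A
  exact ⟨h₁.trans h₃, by dsimp only; omega⟩

theorem map {f : (Fin n → List (Fin n)) → γ} {q : ℕ} (hf : Computes f q) (g : γ → δ) :
    Computes (fun nb => g (f nb)) q :=
  hf.bind (g := fun b _ => g b) fun b => const (g b)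

theorem map₂ {γ' : Type} {f : (Fin n → List (Fin n)) → γ} {f' : (Fin n → List (Fin n)) → γ'}
    {q q' : ℕ} (hf : Computes f q) (hf' : Computes f' q') (g : γ → γ' → δ) :
    Computes (fun nb => g (f nb) (f' nb)) (q + q') :=
  hf.bind (g := fun b nb => g b (f' nb)) fun b => hf'.map (g b)

theorem listMap {f : ι → (Fin n → List (Fin n)) → γ} {q : ℕ} (hf : ∀ i, Computes (f i) q)
    (l : List ι) : Computes (fun nb => l.map fun i => f i nb) (l.length * q) := by
  induction l with
  | nil => simpa using const (n := n) ([] : List γ)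
  | cons a l ih =>
    refine ((hf a).map₂ ih List.cons).mono ?_
    simp [Nat.succ_mul, add_comm]

theorem degree (v : Fin n) : Computes (fun nb => (nb v).length) 1 :=
  ⟨fun k => .askDegree v k, fun k G A => ⟨rfl, by simp [QueryAlg.queries, add_comm]⟩⟩

theorem neighbor (v : Fin n) (i : ℕ) : Computes (fun nb => (nb v)[i]?) 1 :=
  ⟨fun k => .askNeighbor v i k, fun k G A => ⟨rfl, by simp [QueryAlg.queries, add_comm]⟩⟩

theorem exists_queryAlg {f : (Fin n → List (Fin n)) → Bool} {q : ℕ} (hf : Computes f q) :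
    ∃ t : QueryAlg n, ∀ (G : SimpleGraph (Fin n)) (A : AdjacencyList G),
      t.run A = f A.nbrs ∧ t.queries A ≤ q := by
  obtain ⟨p, hp⟩ := hf
  exact ⟨p .halt, fun G A => by simpa [QueryAlg.run, QueryAlg.queries] using hp .halt G A⟩

end Computes

/-! ### Truncated balls and the local greedy selection. -/

section Ball

variable {n : ℕ} (Δ : ℕ) (nb : Fin n → List (Fin n))

/-- The neighbors of `v`, or no vertices at all if there are more than `Δ` of them. -/
def cappedNbrs (v : Fin n) : List (Fin n) := if (nb v).length ≤ Δ then nb v else []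

theorem length_cappedNbrs_le (v : Fin n) : (cappedNbrs Δ nb v).length ≤ Δ := by
  unfold cappedNbrs; split <;> simp_all

theorem computes_cappedNbrs (v : Fin n) : Computes (fun nb => cappedNbrs Δ nb v) (1 + Δ) := by
  have key : ∀ d : ℕ, Computes (fun nb : Fin n → List (Fin n) => if d ≤ Δ then
      ((List.range d).map fun i => (nb v)[i]?).reduceOption else []) Δ := by
    intro d
    by_cases hd : d ≤ Δ
    · simp only [hd, if_true]
      exact ((Computes.listMap (fun i => Computes.neighbor v i) (List.range d)).map
        List.reduceOption).mono (by simpa using hd)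
    · simp only [hd, if_false]
      exact (Computes.const _).mono (Nat.zero_le _)
  have h := (Computes.degree v).bind key
  convert h using 2 with nb
  have : ((List.range (nb v).length).map fun i => (nb v)[i]?) = (nb v).map some :=
    List.ext_getElem (by simp) fun i _ _ => by simp_all
  rw [this]
  simp [List.reduceOption, cappedNbrs]

/-- The vertices reached from `v` in at most `r` steps, none of which leaves a vertex of degree
more than `Δ`. -/
def cappedBall : ℕ → Fin n → List (Fin n)
  | 0, v => [v]
  | r + 1, v => v :: (cappedNbrs Δ nb v).flatMap (cappedBall r)

/-- An upper bound for the size of a ball of radius `r` in a graph of maximum degree `Δ`. -/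
def ballBound : ℕ → ℕ
  | 0 => 1
  | r + 1 => 1 + Δ * ballBound r

/-- The number of queries needed to explore a ball of radius `r`. -/
def ballQueries : ℕ → ℕ
  | 0 => 0
  | r + 1 => (1 + Δ) + Δ * ballQueries r

theorem length_cappedBall_le (r : ℕ) (v : Fin n) :
    (cappedBall Δ nb r v).length ≤ ballBound Δ r := by
  induction r generalizing v with
  | zero => simp [cappedBall, ballBound]
  | succ r ih =>
    have h : ((cappedNbrs Δ nb v).map fun u => (cappedBall Δ nb r u).length).sum ≤
        (cappedNbrs Δ nb v).length * ballBound Δ r := by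
      refine (List.sum_le_card_nsmul _ (ballBound Δ r) ?_).trans (by simp)
      simpa using fun u _ => ih u
    have h' := Nat.mul_le_mul_right (ballBound Δ r) (length_cappedNbrs_le Δ nb v)
    simp only [cappedBall, ballBound, List.length_cons, List.length_flatMap]
    omega

theorem computes_cappedBall (r : ℕ) (v : Fin n) :
    Computes (fun nb => cappedBall Δ nb r v) (ballQueries Δ r) := by
  induction r generalizing v with
  | zero => exact Computes.const _
  | succ r ih =>
    -- The value `[]` for long lists only serves the uniform bound that `bind` asks for;
    -- `cappedNbrs` never returns such a list.
    have key : ∀ l : List (Fin n), Computes (fun nb => if l.length ≤ Δ then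
        v :: l.flatMap (cappedBall Δ nb r) else []) (Δ * ballQueries Δ r) := by
      intro l
      by_cases hl : l.length ≤ Δ
      · simp only [hl, if_true, List.flatMap]
        exact ((Computes.listMap ih l).map fun l' => v :: l'.flatten).mono
          (Nat.mul_le_mul_right _ hl)
      · simp only [hl, if_false]
        exact (Computes.const _).mono (Nat.zero_le _)
    have h := (computes_cappedNbrs Δ v).bind key
    simp only [length_cappedNbrs_le, if_true] at h
    exact h

variable (r : ℕ)

/-- No vertex of degree more than `Δ` is within distance `r` of `v`. -/
def IsLow (v : Fin n) : Prop := ∀ u ∈ cappedBall Δ nb r v, (nb u).length ≤ Δ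

theorem computes_forall_cappedBall {P : Fin n → (Fin n → List (Fin n)) → Prop} {q : ℕ}
    (hP : ∀ u, Computes (P u) q) (v : Fin n) :
    Computes (fun nb => ∀ u ∈ cappedBall Δ nb r v, P u nb)
      (ballQueries Δ r + ballBound Δ r * q) := by
  have key : ∀ l : List (Fin n), Computes (fun nb => l.length ≤ ballBound Δ r ∧
      ∀ u ∈ l, P u nb) (ballBound Δ r * q) := by
    intro l
    by_cases hl : l.length ≤ ballBound Δ r
    · have h := ((Computes.listMap hP l).map fun l' => ∀ p ∈ l', p).mono
        (Nat.mul_le_mul_right q hl)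
      simpa only [hl, true_and, List.forall_mem_map] using h
    · simp only [hl, false_and]
      exact (Computes.const _).mono (Nat.zero_le _)
  have h := (computes_cappedBall Δ r v).bind key
  simpa only [length_cappedBall_le, true_and] using h

theorem computes_isLow (v : Fin n) :
    Computes (fun nb => IsLow Δ nb r v) (ballQueries Δ r + ballBound Δ r * 1) :=
  computes_forall_cappedBall Δ r (fun u => (Computes.degree u).map fun d => d ≤ Δ) v

/-- The vertices selected by the greedy algorithm when it has processed the colors below `j`: a
low vertex is selected unless a vertex selected at an earlier color is within distance `r`. -/
def Greedy (χ : Fin n → ℕ) : ℕ → Fin n → Prop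
  | 0, _ => False
  | j + 1, v => Greedy χ j v ∨
      (χ v = j ∧ IsLow Δ nb r v ∧ ∀ u ∈ cappedBall Δ nb r v, ¬ Greedy χ j u)

/-- The number of queries needed to decide whether the greedy algorithm selects a vertex. -/
def greedyQueries : ℕ → ℕ
  | 0 => 0
  | j + 1 => greedyQueries j + ((ballQueries Δ r + ballBound Δ r * 1) +
      (ballQueries Δ r + ballBound Δ r * greedyQueries j))

theorem computes_greedy (χ : Fin n → ℕ) (j : ℕ) (v : Fin n) :
    Computes (fun nb => Greedy Δ nb r χ j v) (greedyQueries Δ r j) := by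
  induction j generalizing v with
  | zero => exact Computes.const _
  | succ j ih =>
    exact (ih v).map₂ ((computes_isLow Δ r v).map₂ (computes_forall_cappedBall Δ r
      (fun u => (ih u).map Not) v) fun a b => χ v = j ∧ a ∧ b) Or

variable {Δ nb r}

theorem Greedy.mono {χ : Fin n → ℕ} {i j : ℕ} (hij : i ≤ j) {v : Fin n}
    (h : Greedy Δ nb r χ i v) : Greedy Δ nb r χ j v := by
  induction j, hij using Nat.le_induction with
  | base => exact h
  | succ j _ ih => exact Or.inl ih

/-- A vertex can enter only in the round of its own color, and later rounds remove nothing. -/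
theorem Greedy.spec {χ : Fin n → ℕ} {j : ℕ} {v : Fin n} (h : Greedy Δ nb r χ j v) :
    IsLow Δ nb r v ∧ Greedy Δ nb r χ (χ v + 1) v ∧
      ∀ u ∈ cappedBall Δ nb r v, ¬ Greedy Δ nb r χ (χ v) u := by
  induction j with
  | zero => exact h.elim
  | succ j ih =>
    rcases h with h | ⟨rfl, h₁, h₂⟩
    · exact ih h
    · exact ⟨h₁, Or.inr ⟨rfl, h₁, h₂⟩, h₂⟩

/-- Maximality of the selection: either an earlier selected vertex blocks `v`, or `v` itself is
selected in its round. -/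
theorem IsLow.exists_greedy {χ : Fin n → ℕ} {j : ℕ} {v : Fin n} (hv : IsLow Δ nb r v)
    (hj : χ v < j) (hself : v ∈ cappedBall Δ nb r v) :
    ∃ u ∈ cappedBall Δ nb r v, Greedy Δ nb r χ j u := by
  by_cases h : ∃ u ∈ cappedBall Δ nb r v, Greedy Δ nb r χ (χ v) u
  · obtain ⟨u, hu, hg⟩ := h
    exact ⟨u, hu, hg.mono hj.le⟩
  · push Not at h
    exact ⟨v, hself, Greedy.mono (i := χ v + 1) hj (Or.inr ⟨rfl, hv, h⟩)⟩

theorem self_mem_cappedBall (r : ℕ) (v : Fin n) : v ∈ cappedBall Δ nb r v := by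
  cases r <;> simp [cappedBall]

end Ball

/-! ### Truncated balls versus metric balls. -/

section Distance

variable {n : ℕ} {G : SimpleGraph (Fin n)} (A : AdjacencyList G) {Δ : ℕ}

theorem edist_le_of_mem_cappedBall {r : ℕ} {u v : Fin n} (h : u ∈ cappedBall Δ A.nbrs r v) :
    G.edist v u ≤ r := by
  induction r generalizing v with
  | zero => simp_all [cappedBall]
  | succ r ih =>
    simp only [cappedBall, List.mem_cons, List.mem_flatMap] at h
    rcases h with rfl | ⟨w, hw, h⟩
    · simp
    · have hvw : G.Adj v w := by
        rw [← A.mem_iff]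
        unfold cappedNbrs at hw
        split at hw <;> simp_all
      calc G.edist v u ≤ G.edist v w + G.edist w u := SimpleGraph.edist_triangle
        _ ≤ 1 + r := add_le_add (SimpleGraph.edist_eq_one_iff_adj.2 hvw).le (ih h)
        _ = ((r + 1 : ℕ) : ℕ∞) := by push_cast; ring

/-- Around a low vertex nothing is truncated, so a walk can be followed step by step; after one step
the new vertex is low for the radius reduced by one. -/
theorem IsLow.mem_cappedBall {r : ℕ} {u v : Fin n} (hv : IsLow Δ A.nbrs r v)
    (h : G.edist v u ≤ r) : u ∈ cappedBall Δ A.nbrs r v := by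
  have key : ∀ (r : ℕ) (v : Fin n), IsLow Δ A.nbrs r v → ∀ p : G.Walk v u, p.length ≤ r →
      u ∈ cappedBall Δ A.nbrs r v := by
    intro r
    induction r with
    | zero =>
      intro v _ p hp
      cases p with
      | nil => exact self_mem_cappedBall _ _
      | cons _ _ => simp at hp
    | succ r ih =>
      intro v hv p hp
      cases p with
      | nil => exact self_mem_cappedBall _ _
      | @cons _ w _ hadj p =>
        have hw : w ∈ cappedNbrs Δ A.nbrs v := by
          rw [cappedNbrs, if_pos (hv v (self_mem_cappedBall _ _))]
          exact (A.mem_iff v w).2 hadj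
        have hsub : ∀ x ∈ cappedBall Δ A.nbrs r w, x ∈ cappedBall Δ A.nbrs (r + 1) v :=
          fun x hx => List.mem_cons_of_mem _ (List.mem_flatMap.2 ⟨w, hw, hx⟩)
        exact hsub u (ih w (fun x hx => hv x (hsub x hx)) p (by simpa using hp))
  have hne : G.edist v u ≠ ⊤ := fun h' => by simp [h'] at h
  obtain ⟨p, hp⟩ := SimpleGraph.exists_walk_of_edist_ne_top hne
  exact key r v hv p (by rw [← hp] at h; exact_mod_cast h)

end Distance

end TolerantTesting

namespace TolerantTesting

/-! ### Separated sets, covers and the edit distance to small diameter. -/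

section Cover

variable {n : ℕ} {G H : SimpleGraph (Fin n)}

/-- On a shortest path to `root` in `H`, either all edges are in `G` or there is a first edge
outside `G`. -/
theorem exists_edist_le_dist (hH : H.Connected) (root : Fin n) (d : ℕ) (v : Fin n)
    (hv : H.dist v root = d) : ∃ x, G.edist v x ≤ d ∧ (x = root ∨
      ∃ y, H.Adj x y ∧ ¬ G.Adj x y ∧ H.dist y root < H.dist x root) := by
  induction d generalizing v with
  | zero =>
    refine ⟨v, by simp, Or.inl ?_⟩
    exact (hH.dist_eq_zero_iff).1 hv
  | succ d ih =>
    obtain ⟨p, hp⟩ := hH.exists_walk_length_eq_dist v root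
    cases p with
    | nil => simp at hv
    | @cons _ w _ hadj p =>
      have hw : H.dist w root = d := by
        have h₁ := SimpleGraph.dist_le p
        have h₂ := hH.dist_triangle (u := v) (v := w) (w := root)
        rw [SimpleGraph.dist_eq_one_iff_adj.2 hadj] at h₂
        simp at hp
        omega
      by_cases hG : G.Adj v w
      · obtain ⟨x, hx, h⟩ := ih w hw
        refine ⟨x, ?_, h⟩
        calc G.edist v x ≤ G.edist v w + G.edist w x := SimpleGraph.edist_triangle
          _ ≤ 1 + d := add_le_add (SimpleGraph.edist_eq_one_iff_adj.2 hG).le hx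
          _ = ((d + 1 : ℕ) : ℕ∞) := by push_cast; ring
      · exact ⟨v, by simp, Or.inr ⟨w, hadj, hG, by omega⟩⟩

/-- If a graph of diameter at most `D` arises from `G` by adding `k` edges (and removing others),
then a set of vertices at pairwise distances more than `2 * D` has at most `k + 1` elements. -/
theorem card_le_of_ediam_le {D : ℕ} (hH : H.ediam ≤ D) (S : Finset (Fin n))
    (hS : ∀ u ∈ S, ∀ v ∈ S, u ≠ v → ¬ G.edist u v ≤ (2 * D : ℕ)) :
    S.card ≤ (symmDiff G.edgeSet H.edgeSet).ncard + 1 := by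
  classical
  rcases S.eq_empty_or_nonempty with rfl | ⟨root, -⟩
  · simp
  have hfin : ∀ u v, H.edist u v ≤ D := fun u v => SimpleGraph.edist_le_ediam.trans hH
  have hconn : H.Connected := by
    have : Nonempty (Fin n) := ⟨root⟩
    refine ⟨fun u v => ?_⟩
    by_contra h
    have := hfin u v
    rw [SimpleGraph.edist_eq_top_of_not_reachable h] at this
    simp at this
  have hdist : ∀ v, H.dist v root ≤ D := fun v => by
    have h := hfin v root
    rw [← (hconn v root).coe_dist_eq_edist] at h
    exact_mod_cast h
  choose f hf hf' using fun v => exists_edist_le_dist (G := G) hconn root _ v rfl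
  have hfD : ∀ v, G.edist v (f v) ≤ D := fun v => (hf v).trans (by exact_mod_cast hdist v)
  -- Two vertices that leave `G` at the same point are both within `D` of it in `G`, hence within `2
  -- * D` of each other.
  have hinj : Set.InjOn f S := by
    intro u hu v hv huv
    by_contra hne
    refine hS u hu v hv hne ?_
    calc G.edist u v ≤ G.edist u (f u) + G.edist (f u) v := SimpleGraph.edist_triangle
      _ ≤ D + D := add_le_add (hfD u) (by rw [huv, SimpleGraph.edist_comm]; exact hfD v)
      _ = ((2 * D : ℕ) : ℕ∞) := by push_cast; ring
  have hy : ∀ x ∈ (S.image f).erase root, ∃ y, H.Adj x y ∧ ¬ G.Adj x y ∧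
      H.dist y root < H.dist x root := by
    intro x hx
    obtain ⟨hne, hx⟩ := Finset.mem_erase.1 hx
    obtain ⟨v, -, rfl⟩ := Finset.mem_image.1 hx
    exact (hf' v).resolve_left hne
  choose! g hg using hy
  have hle : ((S.image f).erase root).card ≤ (symmDiff G.edgeSet H.edgeSet).ncard := by
    rw [← Set.ncard_coe_finset]
    -- The added edge determines `x`, as its endpoint farther from the root in `H`.
    refine Set.ncard_le_ncard_of_injOn (fun x => s(x, g x)) ?_ ?_ (Set.toFinite _)
    · intro x hx
      obtain ⟨h₁, h₂, -⟩ := hg x hx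
      exact Or.inr ⟨h₁, h₂⟩
    · intro x hx y hy hxy
      have h₁ := (hg x hx).2.2
      have h₂ := (hg y hy).2.2
      simp only [Sym2.eq_iff] at hxy
      rcases hxy with h | ⟨h, h'⟩
      · exact h.1
      · rw [h'] at h₁
        rw [← h] at h₂
        exact absurd h₁ h₂.asymm
  have h₁ : S.card = (S.image f).card := (Finset.card_image_of_injOn hinj).symm
  have h₂ := Finset.pred_card_le_card_erase (s := S.image f) (a := root)
  omega

/-- A graph with `k` centers within distance `r` of all vertices can be given diameter at most
`2 * r + 2` by adding `k - 1` edges. -/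
theorem exists_ediam_le {r : ℕ} (C : Finset (Fin n)) (hC : C.Nonempty)
    (hcov : ∀ v, ∃ x ∈ C, G.edist v x ≤ r) :
    ∃ H : SimpleGraph (Fin n), H.ediam ≤ (2 * r + 2 : ℕ) ∧
      (symmDiff G.edgeSet H.edgeSet).ncard + 1 ≤ C.card := by
  classical
  obtain ⟨hub, hhub⟩ := hC
  -- A star on `C` with center `hub`.
  let E : Set (Sym2 (Fin n)) := (fun x => s(hub, x)) '' (C.erase hub : Finset (Fin n))
  refine ⟨G ⊔ SimpleGraph.fromEdgeSet E, ?_, ?_⟩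
  · set H := G ⊔ SimpleGraph.fromEdgeSet E
    have hGH : G ≤ H := le_sup_left
    have hstep : ∀ x ∈ C, H.edist x hub ≤ 1 := by
      intro x hx
      by_cases h : x = hub
      · simp [h]
      · refine (SimpleGraph.edist_eq_one_iff_adj.2 (Or.inr ?_)).le
        rw [SimpleGraph.fromEdgeSet_adj]
        exact ⟨⟨x, by simp [h, hx], Sym2.eq_swap⟩, h⟩
    have hhubdist : ∀ v, H.edist v hub ≤ r + 1 := by
      intro v
      obtain ⟨x, hx, h⟩ := hcov v
      exact SimpleGraph.edist_triangle.trans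
        (add_le_add ((SimpleGraph.edist_anti hGH).trans h) (hstep x hx))
    refine SimpleGraph.ediam_le_of_edist_le fun u v => ?_
    calc H.edist u v ≤ H.edist u hub + H.edist hub v := SimpleGraph.edist_triangle
      _ ≤ (r + 1) + (r + 1) := add_le_add (hhubdist u)
          (by rw [SimpleGraph.edist_comm]; exact hhubdist v)
      _ = ((2 * r + 2 : ℕ) : ℕ∞) := by push_cast; ring
  · have hsub : symmDiff G.edgeSet (G ⊔ SimpleGraph.fromEdgeSet E).edgeSet ⊆ E := by
      rw [SimpleGraph.edgeSet_sup, SimpleGraph.edgeSet_fromEdgeSet]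
      rintro e (⟨h, h'⟩ | ⟨h | h, h'⟩)
      · exact absurd (Or.inl h) h'
      · exact absurd h h'
      · exact h.1
    have h₁ : E.ncard ≤ (C.erase hub).card := by
      rw [← Set.ncard_coe_finset]
      exact Set.ncard_image_le (Set.toFinite _)
    have h₂ := Set.ncard_le_ncard hsub (Set.toFinite _)
    have h₃ := Finset.card_erase_add_one hhub
    omega

/-- Markov's inequality for the number of vertices of large degree. -/
theorem card_filter_degree_mul_le (A : AdjacencyList G) (Δ : ℕ) :
    (Finset.univ.filter fun v => Δ < (A.nbrs v).length).card * Δ ≤ 2 * G.edgeSet.ncard := by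
  classical
  have hdeg : ∀ v, (A.nbrs v).length = G.degree v := by
    intro v
    rw [← List.toFinset_card_of_nodup (A.nodup v), ← SimpleGraph.card_neighborFinset_eq_degree]
    congr 1
    ext u
    simp [A.mem_iff]
  calc _ ≤ ∑ v ∈ Finset.univ.filter fun v => Δ < (A.nbrs v).length, G.degree v := by
        rw [← smul_eq_mul]
        refine Finset.card_nsmul_le_sum _ _ _ fun v hv => ?_
        rw [← hdeg]
        exact (Finset.mem_filter.1 hv).2.le
    _ ≤ ∑ v, G.degree v := Finset.sum_le_sum_of_subset (Finset.filter_subset _ _)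
    _ = 2 * G.edgeSet.ncard := by
        rw [G.sum_degrees_eq_twice_card_edges, ← SimpleGraph.coe_edgeFinset, Set.ncard_coe_finset]

end Cover

/-! ### Moments, collisions and Markov's inequality for uniform choices. -/

section Sampling

/-- The second moment of a sum of independent samples of a function with mean zero. -/
theorem sum_sq_sum_eq {α : Type*} [Fintype α] (g : α → ℝ) (hg : ∑ a, g a = 0) (t : ℕ) :
    (Fintype.card α : ℝ) * ∑ x : Fin t → α, (∑ i, g (x i)) ^ 2 =
      (Fintype.card α : ℝ) ^ t * (t * ∑ a, g a ^ 2) := by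
  induction t with
  | zero => simp
  | succ t ih =>
    -- Splitting off the first sample; the cross term vanishes because `g` sums to zero.
    have h : ∑ x : Fin (t + 1) → α, (∑ i, g (x i)) ^ 2 =
        (Fintype.card α : ℝ) ^ t * ∑ a, g a ^ 2 +
          Fintype.card α * ∑ x : Fin t → α, (∑ i, g (x i)) ^ 2 := by
      rw [← (Fin.consEquiv fun _ => α).sum_comp, Fintype.sum_prod_type]
      simp only [Fin.consEquiv_apply, Fin.sum_univ_succ, Fin.cons_zero, Fin.cons_succ, add_sq,
        Finset.sum_add_distrib, Finset.sum_const, Finset.card_univ, ← Finset.sum_mul,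
        ← Finset.mul_sum, hg]
      simp [Finset.mul_sum]
    rw [h, mul_add, ih]
    push_cast
    ring

/-- The number of colorings in which two given vertices have the same color. -/
theorem card_filter_eq_mul_le {α : Type*} [Fintype α] [DecidableEq α] (L : ℕ) {u v : α}
    (huv : u ≠ v) :
    (Finset.univ.filter fun χ : α → Fin L => χ u = χ v).card * L ≤
      Fintype.card (α → Fin L) := by
  suffices h : ((Finset.univ.filter fun χ : α → Fin L => χ u = χ v) ×ˢ
      (Finset.univ : Finset (Fin L))).card ≤ (Finset.univ : Finset (α → Fin L)).card by
    rwa [Finset.card_product, Finset.card_univ, Finset.card_univ, Fintype.card_fin] at h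
  -- Overwriting the color of `u` loses nothing: the old value is still the color of `v`.
  refine Finset.card_le_card_of_injOn (fun p => Function.update p.1 u p.2) (by simp) ?_
  rintro ⟨χ, a⟩ h ⟨χ', a'⟩ h' heq
  simp only [Finset.coe_product, Set.mem_prod, Finset.mem_coe, Finset.mem_filter] at h h'
  have ha : ∀ w, Function.update χ u a w = Function.update χ' u a' w := fun w => congrFun heq w
  have hne : ∀ w, w ≠ u → χ w = χ' w := fun w hw => by simpa [hw] using ha w
  refine Prod.ext (funext fun w => ?_) (by simpa using ha u)
  by_cases hw : w = u
  · subst hw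
    simp only
    rw [h.1.2, h'.1.2, hne v huv.symm]
  · exact hne w hw

theorem acceptProb_map_uniformOfFintype {Ω : Type} [Fintype Ω] [Nonempty Ω] {n : ℕ}
    {G : SimpleGraph (Fin n)} (A : AdjacencyList G) (alg : Ω → QueryAlg n) :
    acceptProb ((PMF.uniformOfFintype Ω).map alg) A =
      ((Finset.univ.filter fun ω => (alg ω).run A = true).card : ℝ) / Fintype.card Ω := by
  classical
  rw [acceptProb, PMF.map_comp, PMF.map_apply, tsum_fintype]
  simp only [PMF.uniformOfFintype_apply, Function.comp_apply, eq_comm (a := true)]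
  rw [← Finset.sum_filter, Finset.sum_const, nsmul_eq_mul, ENNReal.toReal_mul]
  simp [div_eq_mul_inv]

/-- Markov's inequality for a uniformly distributed element of a finite type. -/
theorem card_filter_le_sum {Ω : Type*} [Fintype Ω] (p : Ω → Prop) [DecidablePred p] (f : Ω → ℝ)
    (hf : ∀ ω, 0 ≤ f ω) (hp : ∀ ω, p ω → 1 ≤ f ω) :
    ((Finset.univ.filter p).card : ℝ) ≤ ∑ ω, f ω := by
  calc ((Finset.univ.filter p).card : ℝ) = ∑ ω ∈ Finset.univ.filter p, (1 : ℝ) := by simp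
    _ ≤ ∑ ω ∈ Finset.univ.filter p, f ω :=
        Finset.sum_le_sum fun ω hω => hp ω (Finset.mem_filter.1 hω).2
    _ ≤ ∑ ω, f ω := Finset.sum_le_sum_of_subset_of_nonneg (Finset.filter_subset _ _)
        fun ω _ _ => hf ω

end Sampling

end TolerantTesting

namespace TolerantTesting

open scoped Classical

/-! ### The number of centers: conflicts, upper bound and lower bound. -/

section Centers

variable {n : ℕ} (Δ : ℕ) (nb : Fin n → List (Fin n)) (r : ℕ)

/-- The vertices selected by the greedy algorithm. -/
noncomputable def centers {L : ℕ} (χ : Fin n → Fin L) : Finset (Fin n) :=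
  Finset.univ.filter (Greedy Δ nb r (fun v => χ v) L)

/-- The vertices that share their color with another vertex of their ball. -/
noncomputable def conflicts {L : ℕ} (χ : Fin n → Fin L) : Finset (Fin n) :=
  Finset.univ.filter fun v => ∃ u ∈ cappedBall Δ nb r v, u ≠ v ∧ χ u = χ v

/-- Union bound over the pairs of a vertex and another member of its ball; each pair has equal
colors with probability at most `1 / L`. -/
theorem sum_card_conflicts_mul_le (L : ℕ) :
    (∑ χ : Fin n → Fin L, (conflicts Δ nb r χ).card) * L ≤
      n * ballBound Δ r * Fintype.card (Fin n → Fin L) := by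
  let B : Fin n → Finset (Fin n) := fun v => (cappedBall Δ nb r v).toFinset.erase v
  have hB : ∀ v, (B v).card ≤ ballBound Δ r := fun v =>
    (Finset.card_erase_le.trans (List.toFinset_card_le _)).trans (length_cappedBall_le Δ nb r v)
  have h : ∀ χ : Fin n → Fin L, (conflicts Δ nb r χ).card ≤
      ∑ v, ∑ u ∈ B v, if χ u = χ v then 1 else 0 := by
    intro χ
    rw [conflicts, Finset.card_filter]
    refine Finset.sum_le_sum fun v _ => ?_
    split_ifs with hv
    · obtain ⟨u, hu, hne, heq⟩ := hv
      rw [← Finset.card_filter]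
      exact Finset.card_pos.2 ⟨u, by simp [B, hu, hne, heq]⟩
    · exact Nat.zero_le _
  calc (∑ χ : Fin n → Fin L, (conflicts Δ nb r χ).card) * L
      ≤ (∑ χ : Fin n → Fin L, ∑ v, ∑ u ∈ B v, if χ u = χ v then 1 else 0) * L :=
        Nat.mul_le_mul_right _ (Finset.sum_le_sum fun χ _ => h χ)
    _ = ∑ v, ∑ u ∈ B v, (Finset.univ.filter fun χ : Fin n → Fin L => χ u = χ v).card * L := by
        rw [Finset.sum_comm, Finset.sum_mul]
        refine Finset.sum_congr rfl fun v _ => ?_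
        rw [Finset.sum_comm, Finset.sum_mul]
        simp only [Finset.card_filter]
    _ ≤ ∑ v : Fin n, ballBound Δ r * Fintype.card (Fin n → Fin L) := by
        refine Finset.sum_le_sum fun v _ => ?_
        refine (Finset.sum_le_card_nsmul _ _ _ fun u hu =>
          card_filter_eq_mul_le L (Finset.ne_of_mem_erase hu)).trans ?_
        exact Nat.mul_le_mul_right _ (hB v)
    _ = _ := by simp [mul_assoc]

variable {Δ} {r}
variable {G : SimpleGraph (Fin n)} (A : AdjacencyList G)

/-- Of two centers within `2 * D`, one with a later color would have been blocked, so their colors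
agree and both are conflicts. The centers without conflict are therefore separated. -/
theorem card_centers_le {D L : ℕ} (χ : Fin n → Fin L) {H : SimpleGraph (Fin n)}
    (hH : H.ediam ≤ D) :
    (centers Δ A.nbrs (2 * D) χ).card ≤
      (symmDiff G.edgeSet H.edgeSet).ncard + 1 + (conflicts Δ A.nbrs (2 * D) χ).card := by
  set S := centers Δ A.nbrs (2 * D) χ with hS
  set C := conflicts Δ A.nbrs (2 * D) χ with hC
  have hlt : ∀ u ∈ S, ∀ v ∈ S, G.edist v u ≤ (2 * D : ℕ) → ¬ (χ u : ℕ) < χ v := by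
    intro u hu v hv hd h
    have hu' := (Finset.mem_filter.1 hu).2.spec
    have hv' := (Finset.mem_filter.1 hv).2.spec
    exact hv'.2.2 u (hv'.1.mem_cappedBall A hd) (hu'.2.1.mono h)
  have h := card_le_of_ediam_le (G := G) hH (S \ C) fun u hu v hv hne hd => by
    obtain ⟨hu, huC⟩ := Finset.mem_sdiff.1 hu
    obtain ⟨hv, -⟩ := Finset.mem_sdiff.1 hv
    have h₁ := hlt v hv u hu hd
    have h₂ := hlt u hu v hv (by rwa [SimpleGraph.edist_comm])
    refine huC (Finset.mem_filter.2 ⟨Finset.mem_univ _, v, ?_, hne.symm, Fin.ext (by omega)⟩)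
    exact (Finset.mem_filter.1 hu).2.spec.1.mem_cappedBall A hd
  have h' := Finset.card_le_card_sdiff_add_card (s := S) (t := C)
  omega

/-- A low vertex has a center in its ball by maximality, and any other vertex has a vertex of high
degree there. -/
theorem exists_ediam_le_centers {L : ℕ} (χ : Fin n → Fin L) (hn : 0 < n) :
    ∃ H : SimpleGraph (Fin n), H.ediam ≤ (2 * r + 2 : ℕ) ∧
      (symmDiff G.edgeSet H.edgeSet).ncard + 1 ≤ (centers Δ A.nbrs r χ).card +
        (Finset.univ.filter fun v => Δ < (A.nbrs v).length).card := by
  have hcov : ∀ v, ∃ x ∈ centers Δ A.nbrs r χ ∪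
      Finset.univ.filter fun v => Δ < (A.nbrs v).length, G.edist v x ≤ r := by
    intro v
    by_cases hv : IsLow Δ A.nbrs r v
    · obtain ⟨u, hu, hg⟩ := hv.exists_greedy (χ := fun v => χ v) (χ v).2 (self_mem_cappedBall r v)
      exact ⟨u, by simp [centers, hg], edist_le_of_mem_cappedBall A hu⟩
    · simp only [IsLow, not_forall, not_le] at hv
      obtain ⟨u, hu, hg⟩ := hv
      exact ⟨u, by simp [hg], edist_le_of_mem_cappedBall A hu⟩
  obtain ⟨x, hx, -⟩ := hcov ⟨0, hn⟩
  obtain ⟨H, h₁, h₂⟩ := exists_ediam_le _ ⟨x, hx⟩ hcov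
  exact ⟨H, h₁, h₂.trans (Finset.card_union_le _ _)⟩

end Centers

/-! ### Estimating the number of centers from random vertices. -/

section Estimate

variable {n : ℕ}

/-- The estimate of the size of `S` from the samples `x`. -/
noncomputable def sizeEstimate {t : ℕ} (S : Finset (Fin n)) (x : Fin t → Fin n) : ℝ :=
  (n : ℝ) / t * ∑ i, if x i ∈ S then 1 else 0

/-- The variance bound for Chebyshev: the centered indicator `g` is bounded by one in absolute
value. -/
theorem sum_sq_sizeEstimate_sub_le {t : ℕ} (hn : 0 < n) (ht : 0 < t) (S : Finset (Fin n)) :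
    ∑ x : Fin t → Fin n, (sizeEstimate S x - S.card) ^ 2 ≤
      (n : ℝ) ^ 2 / t * Fintype.card (Fin t → Fin n) := by
  have hn' : (0 : ℝ) < n := by exact_mod_cast hn
  have ht' : (0 : ℝ) < t := by exact_mod_cast ht
  let g : Fin n → ℝ := fun a => (if a ∈ S then 1 else 0) - S.card / n
  have hcard : (S.card : ℝ) ≤ n := by
    exact_mod_cast (Finset.card_le_univ S).trans (Fintype.card_fin n).le
  have hg : ∑ a, g a = 0 := by
    simp [g, Finset.sum_sub_distrib]
    field_simp
    ring
  have hg2 : ∑ a, g a ^ 2 ≤ n := by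
    have h : ∀ a, g a ^ 2 ≤ 1 := by
      intro a
      have h₀ : 0 ≤ (S.card : ℝ) / n := by positivity
      have h₁ : (S.card : ℝ) / n ≤ 1 := (div_le_one hn').2 hcard
      rw [sq_le_one_iff_abs_le_one, abs_le]
      simp only [g]
      split_ifs <;> constructor <;> linarith
    calc ∑ a, g a ^ 2 ≤ ∑ a : Fin n, (1 : ℝ) := Finset.sum_le_sum fun a _ => h a
      _ = n := by simp
  have hdev : ∀ x : Fin t → Fin n,
      (sizeEstimate S x - S.card) ^ 2 = (n / t : ℝ) ^ 2 * (∑ i, g (x i)) ^ 2 := by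
    intro x
    rw [← mul_pow]
    congr 1
    simp only [sizeEstimate, g, Finset.sum_sub_distrib, Finset.sum_const, Finset.card_univ,
      Fintype.card_fin, nsmul_eq_mul, mul_sub]
    field_simp
  have hsum := sum_sq_sum_eq g hg t
  rw [Fintype.card_fin] at hsum
  have hle : ∑ x : Fin t → Fin n, (∑ i, g (x i)) ^ 2 ≤ (n : ℝ) ^ t * t := by
    refine le_of_mul_le_mul_left ?_ hn'
    rw [hsum]
    have := mul_le_mul_of_nonneg_left hg2 (by positivity : (0 : ℝ) ≤ (n : ℝ) ^ t * t)
    linarith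
  simp only [hdev, ← Finset.mul_sum, Fintype.card_fun, Fintype.card_fin, Nat.cast_pow]
  calc (n / t : ℝ) ^ 2 * ∑ x : Fin t → Fin n, (∑ i, g (x i)) ^ 2
      ≤ (n / t : ℝ) ^ 2 * ((n : ℝ) ^ t * t) := by gcongr
    _ = _ := by field_simp

/-- With high probability there are few conflicts and the estimated number of centers is
accurate. -/
theorem sum_failure_le (Δ : ℕ) (nb : Fin n → List (Fin n)) (r : ℕ) {L t : ℕ} (hn : 0 < n)
    (ht : 0 < t) {B : ℝ} (hB : 0 < B) (hLB : 6 * (n * ballBound Δ r : ℝ) ≤ L * B)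
    (htB : 6 * (n : ℝ) ^ 2 ≤ t * B ^ 2) (hL : 0 < L) :
    ∑ ω : (Fin n → Fin L) × (Fin t → Fin n), (((conflicts Δ nb r ω.1).card : ℝ) / B +
      (sizeEstimate (centers Δ nb r ω.1) ω.2 - (centers Δ nb r ω.1).card) ^ 2 / B ^ 2) ≤
      (1 / 3) * Fintype.card ((Fin n → Fin L) × (Fin t → Fin n)) := by
  have hL' : (0 : ℝ) < L := by exact_mod_cast hL
  have ht' : (0 : ℝ) < t := by exact_mod_cast ht
  have h₁ : ∑ χ : Fin n → Fin L, ((conflicts Δ nb r χ).card : ℝ) / B ≤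
      1 / 6 * Fintype.card (Fin n → Fin L) := by
    have h : (∑ χ : Fin n → Fin L, ((conflicts Δ nb r χ).card : ℝ)) * L ≤
        n * ballBound Δ r * Fintype.card (Fin n → Fin L) := by
      exact_mod_cast sum_card_conflicts_mul_le Δ nb r L
    rw [← Finset.sum_div, div_le_iff₀ hB]
    refine le_of_mul_le_mul_right (h.trans ?_) hL'
    have := mul_le_mul_of_nonneg_right hLB
      (Nat.cast_nonneg (α := ℝ) (Fintype.card (Fin n → Fin L)))
    linarith
  have h₂ : ∀ S : Finset (Fin n), ∑ x : Fin t → Fin n, (sizeEstimate S x - S.card) ^ 2 / B ^ 2 ≤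
      1 / 6 * Fintype.card (Fin t → Fin n) := by
    intro S
    rw [← Finset.sum_div, div_le_iff₀ (by positivity)]
    refine (sum_sq_sizeEstimate_sub_le hn ht S).trans ?_
    have h : (n : ℝ) ^ 2 / t ≤ 1 / 6 * B ^ 2 := by
      rw [div_le_iff₀ ht']
      linarith
    have := mul_le_mul_of_nonneg_right h
      (Nat.cast_nonneg (α := ℝ) (Fintype.card (Fin t → Fin n)))
    linarith
  rw [Fintype.sum_prod_type]
  simp only [Finset.sum_add_distrib, Finset.sum_const, Finset.card_univ, nsmul_eq_mul,
    ← Finset.mul_sum]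
  have h₃ := Finset.sum_le_sum fun (χ : Fin n → Fin L) (_ : χ ∈ Finset.univ) =>
    h₂ (centers Δ nb r χ)
  have h₄ := mul_le_mul_of_nonneg_left h₁
    (Nat.cast_nonneg (α := ℝ) (Fintype.card (Fin t → Fin n)))
  rw [Finset.sum_const, Finset.card_univ, nsmul_eq_mul] at h₃
  rw [Fintype.card_prod, Nat.cast_mul]
  linarith

theorem computes_sizeEstimate_centers (Δ r : ℕ) {L t : ℕ} (χ : Fin n → Fin L)
    (x : Fin t → Fin n) :
    Computes (fun nb => sizeEstimate (centers Δ nb r χ) x) (t * greedyQueries Δ r L) := by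
  have h := (Computes.listMap (fun i : Fin t => (computes_greedy Δ r (fun v => χ v) L (x i)).map
    fun p => if p then (1 : ℝ) else 0) (List.finRange t)).map fun l => (n : ℝ) / t * l.sum
  simpa [← Fin.sum_univ_def, sizeEstimate, centers] using h

end Estimate

/-! ### The tester and its constants. -/

/-- The estimate of the number of centers yields an algorithm with a constant number of queries
that separates graphs with few centers from graphs with many centers. -/
theorem exists_randQueryAlg (Δ r L t n : ℕ) (hn : 0 < n) (hL : 0 < L) (ht : 0 < t) (θ B : ℝ)
    (hB : 0 < B) (hLB : 6 * (n * ballBound Δ r : ℝ) ≤ L * B)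
    (htB : 6 * (n : ℝ) ^ 2 ≤ t * B ^ 2) :
    ∃ T : RandQueryAlg n, ∀ (G : SimpleGraph (Fin n)) (A : AdjacencyList G),
      (∀ a ∈ T.support, a.queries A ≤ t * greedyQueries Δ r L) ∧
      ((∀ χ : Fin n → Fin L, ((centers Δ A.nbrs r χ).card : ℝ) ≤
        θ + (conflicts Δ A.nbrs r χ).card) → 2 / 3 ≤ acceptProb T A) ∧
      ((∀ χ : Fin n → Fin L, θ + 3 * B ≤ (centers Δ A.nbrs r χ).card) →
        acceptProb T A ≤ 1 / 3) := by
  have : Nonempty (Fin n) := ⟨⟨0, hn⟩⟩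
  have : Nonempty (Fin L) := ⟨⟨0, hL⟩⟩
  choose alg halg using fun ω : (Fin n → Fin L) × (Fin t → Fin n) =>
    ((computes_sizeEstimate_centers Δ r ω.1 ω.2).map
      -- With fewer than `B` conflicts a close graph has fewer than `θ + B` centers, a far one has
      -- at least `θ + 3 * B`; the threshold in between tolerates an error of `B`.
      fun s => decide (s ≤ θ + 2 * B)).exists_queryAlg
  refine ⟨(PMF.uniformOfFintype _).map alg, fun G A => ?_⟩
  have hrun := fun ω => (halg ω G A).1
  have hpos : (0 : ℝ) < Fintype.card ((Fin n → Fin L) × (Fin t → Fin n)) := by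
    exact_mod_cast Fintype.card_pos
  have hsum := sum_failure_le Δ A.nbrs r hn ht hB hLB htB hL
  have hdev : ∀ (b : ℝ) {s : ℝ}, 0 ≤ b → B ≤ |s| → 1 ≤ b / B + s ^ 2 / B ^ 2 := by
    intro b s hb hs
    have h₁ : 0 ≤ b / B := by positivity
    have h₂ : 1 ≤ s ^ 2 / B ^ 2 := by
      rw [one_le_div (by positivity), ← sq_abs s]
      gcongr
    linarith
  refine ⟨fun a ha => ?_, fun hclose => ?_, fun hfar => ?_⟩
  · rw [PMF.support_map] at ha
    obtain ⟨ω, -, rfl⟩ := ha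
    exact (halg ω G A).2
  · rw [acceptProb_map_uniformOfFintype, le_div_iff₀ hpos]
    have h := (card_filter_le_sum (fun ω => ¬ (alg ω).run A = true) _
      (fun ω => by positivity) fun ω hω => ?_).trans hsum
    · have hadd := Finset.card_filter_add_card_filter_not
        (s := (Finset.univ : Finset ((Fin n → Fin L) × (Fin t → Fin n))))
        (fun ω => (alg ω).run A = true)
      rw [Finset.card_univ] at hadd
      rw [← hadd] at h ⊢
      push_cast at h ⊢
      linarith
    · rw [hrun, decide_eq_true_iff, not_le] at hω
      have hc := hclose ω.1
      by_cases hconf : B ≤ (conflicts Δ A.nbrs r ω.1).card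
      · have h₁ := (one_le_div hB).2 hconf
        have h₂ : 0 ≤ (sizeEstimate (centers Δ A.nbrs r ω.1) ω.2 -
          (centers Δ A.nbrs r ω.1).card) ^ 2 / B ^ 2 := by positivity
        linarith
      · refine hdev _ (by positivity) (le_abs.2 (Or.inl ?_))
        linarith
  · rw [acceptProb_map_uniformOfFintype, div_le_iff₀ hpos]
    refine (card_filter_le_sum _ _ (fun ω => by positivity) fun ω hω => ?_).trans hsum
    rw [hrun, decide_eq_true_iff] at hω
    have hc := hfar ω.1
    refine hdev _ (by positivity) (le_abs.2 (Or.inr ?_))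
    linarith

end TolerantTesting

theorem corollaryc (D : ℕ) (hD : 0 < D) (α β ε c κ : ℝ) (hα : 0 < α) (hβ : 0 < β) (hε : 0 < ε)
    (hc₀ : 0 < c) (hc₁ : c < 1) (hκ : 0 < κ) :
    ∃ T : (n m : ℕ) → TolerantTesting.RandQueryAlg n,
      TolerantTesting.IsTolerantTester TolerantTesting.diamAtMost D (fun s => 4 * s + 6)
        (fun _ => ε) (fun m => (3 + α) * ε + 1 / (m : ℝ) + c + β)
        (fun n m => 1 / c ≤ (n : ℝ) ∧ κ * (n : ℝ) ≤ (m : ℝ)) T := by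
  open TolerantTesting in
  -- With `B = c * m / 4` and `κ * n ≤ m`: `Δ` leaves at most `2 * m / Δ ≤ B` vertices of high
  -- degree, `L` makes the expected number of conflicts at most `B / 6`, and `t` makes the variance
  -- of the estimate at most `B ^ 2 / 6`.
  obtain ⟨Δ, hΔ⟩ := exists_nat_ge (8 / c)
  obtain ⟨L, hL⟩ := exists_nat_ge (24 * ballBound Δ (2 * D) / (κ * c))
  obtain ⟨t, ht⟩ := exists_nat_ge (96 / (κ * c) ^ 2)
  have hΔ' : 8 ≤ Δ * c := (div_le_iff₀ hc₀).1 hΔ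
  have hL' := (div_le_iff₀ (by positivity)).1 hL
  have ht' := (div_le_iff₀ (by positivity)).1 ht
  have hball : 0 < ballBound Δ (2 * D) := by
    cases D <;> simp [ballBound, Nat.mul_succ]
  have hLpos : 0 < L := Nat.pos_of_ne_zero fun h => by
    have : (0 : ℝ) < ballBound Δ (2 * D) := by exact_mod_cast hball
    rw [h] at hL'
    simp only [CharP.cast_eq_zero, zero_mul] at hL'
    linarith
  have htpos : 0 < t := Nat.pos_of_ne_zero fun h => by
    rw [h] at ht'
    norm_num at ht'
  have hpos : ∀ n m : ℕ, 1 / c ≤ (n : ℝ) ∧ κ * (n : ℝ) ≤ (m : ℝ) → 0 < n ∧ (0 : ℝ) < m := by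
    intro n m h
    have hn : (0 : ℝ) < n := lt_of_lt_of_le (by positivity) h.1
    exact ⟨by exact_mod_cast hn, lt_of_lt_of_le (by positivity) h.2⟩
  have hex : ∀ n m : ℕ, ∃ T : RandQueryAlg n, (1 / c ≤ (n : ℝ) ∧ κ * (n : ℝ) ≤ (m : ℝ)) →
      ∀ (G : SimpleGraph (Fin n)) (A : AdjacencyList G),
      (∀ a ∈ T.support, a.queries A ≤ t * greedyQueries Δ (2 * D) L) ∧
      ((∀ χ : Fin n → Fin L, ((centers Δ A.nbrs (2 * D) χ).card : ℝ) ≤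
        ε * m + 1 + (conflicts Δ A.nbrs (2 * D) χ).card) → 2 / 3 ≤ acceptProb T A) ∧
      ((∀ χ : Fin n → Fin L, ε * m + 1 + 3 * (c * m / 4) ≤
        (centers Δ A.nbrs (2 * D) χ).card) → acceptProb T A ≤ 1 / 3) := by
    intro n m
    by_cases h : 1 / c ≤ (n : ℝ) ∧ κ * (n : ℝ) ≤ (m : ℝ)
    · obtain ⟨hn, hm⟩ := hpos n m h
      have hLB : 6 * (n * ballBound Δ (2 * D) : ℝ) ≤ L * (c * m / 4) := by
        refine le_of_mul_le_mul_left ?_ hκ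
        have h₁ := mul_le_mul_of_nonneg_left h.2
          (by positivity : (0 : ℝ) ≤ 6 * ballBound Δ (2 * D))
        have h₂ := mul_le_mul_of_nonneg_right hL' (by positivity : (0 : ℝ) ≤ m / 4)
        linarith
      have htB : 6 * (n : ℝ) ^ 2 ≤ t * (c * m / 4) ^ 2 := by
        refine le_of_mul_le_mul_left ?_ (by positivity : 0 < κ ^ 2)
        have h₁ : (κ * n) ^ 2 ≤ (m : ℝ) ^ 2 := by gcongr; exact h.2
        have h₂ := mul_le_mul_of_nonneg_right ht' (by positivity : (0 : ℝ) ≤ (m : ℝ) ^ 2 / 16)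
        linarith
      obtain ⟨T, hT⟩ := exists_randQueryAlg Δ (2 * D) L t n hn hLpos htpos (ε * m + 1)
        (c * m / 4) (by positivity) hLB htB
      exact ⟨T, fun _ => hT⟩
    · exact ⟨PMF.pure (.halt true), fun h' => absurd h' h⟩
  choose T hT using hex
  refine ⟨T, ⟨fun _ => t * greedyQueries Δ (2 * D) L, ?_, ?_⟩, ?_, ?_⟩
  · exact Asymptotics.isLittleO_const_left.2 (Or.inr (by
      simpa [Function.comp_def] using tendsto_natCast_atTop_atTop (R := ℝ)))
  · intro n m h G A _
    exact (hT n m h G A).1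
  · rintro n m h G A - ⟨H, hH, hdist⟩
    obtain ⟨-, hm⟩ := hpos n m h
    rw [graphDist, div_le_iff₀ hm] at hdist
    refine (hT n m h G A).2.1 fun χ => ?_
    have : ((centers Δ A.nbrs (2 * D) χ).card : ℝ) ≤
        (symmDiff G.edgeSet H.edgeSet).ncard + 1 + (conflicts Δ A.nbrs (2 * D) χ).card := by
      exact_mod_cast card_centers_le A χ hH
    linarith
  · intro n m h G A hE hfar
    obtain ⟨hn, hm⟩ := hpos n m h
    refine (hT n m h G A).2.2 fun χ => ?_
    -- Fewer than `ε * m + 1 + 3 * B` centers and at most `B` vertices of high degree would allow a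
    -- repair with fewer than `(ε + c) * m` edges, contradicting farness.
    by_contra hlt
    rw [not_le] at hlt
    obtain ⟨H, hH, hcard⟩ := exists_ediam_le_centers (Δ := Δ) (r := 2 * D) A χ hn
    -- The star gives diameter `2 * (2 * D) + 2`, which is below `4 * D + 6`.
    refine hfar ⟨H, hH.trans (by exact_mod_cast (by omega)), ?_⟩
    rw [graphDist, div_le_iff₀ hm]
    have h₁ : ((symmDiff G.edgeSet H.edgeSet).ncard : ℝ) + 1 ≤
        (centers Δ A.nbrs (2 * D) χ).card +
          (Finset.univ.filter fun v => Δ < (A.nbrs v).length).card := by exact_mod_cast hcard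
    have h₂ : ((Finset.univ.filter fun v => Δ < (A.nbrs v).length).card : ℝ) * Δ ≤ 2 * m := by
      exact_mod_cast (card_filter_degree_mul_le A Δ).trans (Nat.mul_le_mul_left 2 hE)
    have h₃ : ((Finset.univ.filter fun v => Δ < (A.nbrs v).length).card : ℝ) ≤ c * m / 4 := by
      have h₄ := mul_le_mul_of_nonneg_left hΔ' (Nat.cast_nonneg (α := ℝ)
        (Finset.univ.filter fun v => Δ < (A.nbrs v).length).card)
      have h₅ := mul_le_mul_of_nonneg_right h₂ hc₀.le
      linarith
    have h₄ : ((3 + α) * ε + 1 / (m : ℝ) + c + β) * m =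
        3 * (ε * m) + α * (ε * m) + 1 + c * m + β * m := by
      field_simp
    rw [h₄]
    have h₅ : 0 ≤ ε * m := by positivity
    have h₆ : 0 ≤ α * (ε * m) := by positivity
    have h₇ : 0 ≤ β * m := by positivity
    linarith
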